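/- Let $T>0$ and let $\Omega\subset\mathbb R^3$ be a bounded open set (for instance a bounded domain of class $\mathcal C^2$). For $3\times3$ matrices put $\mathbf A:\mathbf B=\mathrm{tr}(\mathbf A^{\intercal}\mathbf B)$ and $|\mathbf A|^2=\frac12\mathbf A:\mathbf A$; for a vector field $\mathbf u$ put $\mathbf D\mathbf u=\frac12(\nabla\mathbf u+(\nabla\mathbf u)^{\intercal})$ and $\mathbf S\mathbf u=\mathbf D\mathbf u-\frac13(\mathrm{div}\,\mathbf u)\mathbf I_3$. Let $W_0^{1,3}(\Omega)$ be the closure of the smooth compactly supported vector fields in $W^{1,3}(\Omega)$, let $W^{-1,\frac32}(\Omega)$ be its dual, with duality bracket $\langle\cdot,\cdot\rangle$, and let $\mathbf u_{\mathrm{init}}\in L^2(\Omega)$ and $\mathbf f\in L^{\frac32}(0,T;W^{-1,\frac32}(\Omega))$. A triple $(\mathbf u,p,\boldsymbol\sigma)$ (velocity, pressure, stress tensor) is called a weak solution if $$\mathbf u\in L^\infty(0,T;L^2(\Omega))\cap L^3(0,T;W_0^{1,3}(\Omega)),\qquad \partial_t\mathbf u\in L^{\frac32}(0,T;W^{-1,\frac32}(\Omega)),$$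 $$p\in L^{\frac32}((0,T)\times\Omega),\quad p\ge0\ \text{a.e.},\qquad \boldsymbol\sigma\in L^{\frac32}((0,T)\times\Omega),\quad |\boldsymbol\sigma|\le p,\ \ \boldsymbol\sigma=\boldsymbol\sigma^{\intercal},\ \ \mathrm{tr}\,\boldsymbol\sigma=0\ \text{a.e.},$$ if for all $\boldsymbol\varphi\in L^3(0,T;W_0^{1,3}(\Omega))$ and all $\psi\in L^{\frac32}((0,T)\times\Omega)$ one has, for almost every $t\in(0,T)$, $$\langle\partial_t\mathbf u,\boldsymbol\varphi\rangle-\int_\Omega p\,\mathrm{div}\,\boldsymbol\varphi+\int_\Omega2|\mathbf D\mathbf u|\,\mathbf D\mathbf u:\mathbf D\boldsymbol\varphi+\int_\Omega\boldsymbol\sigma:\mathbf S\boldsymbol\varphi=\langle\mathbf f,\boldsymbol\varphi\rangle,$$ $$\int_\Omega\psi\,\mathrm{div}\,\mathbf u-\int_\Omega2\psi|\mathbf S\mathbf u|+\int_\Omega\psi\sqrt p=0,$$ if the energy inequality $$\frac12\int_\Omega|\mathbf u(T)|^2+4\int_0^T\!\!\int_\Omega|\mathbf D\mathbf u|^3+\int_0^T\!\!\int_\Omega|p|^{\frac32}\le\frac12\int_\Omega|\mathbf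 u_{\mathrm{init}}|^2+\int_0^T\langle\mathbf f,\mathbf u\rangle$$ holds, and if $\mathbf u|_{t=0}=\mathbf u_{\mathrm{init}}$ in $L^2(\Omega)$. (Here $\int_\Omega|\mathbf u(T)|^2$ is understood as the lower limit of $\int_\Omega|\mathbf u(t)|^2$ as $t\to T^-$ outside a null set, and the initial condition as $\mathbf u(t)\to\mathbf u_{\mathrm{init}}$ in $L^2(\Omega)$ as $t\to0^+$ outside a null set; for the representative of $\mathbf u$ in $C([0,T];L^2(\Omega))$ these are its values at $T$ and at $0$.) If $(\mathbf u,p,\boldsymbol\sigma)$ is a weak solution, then the threshold relations $$\boldsymbol\sigma:\mathbf S\mathbf u=2p|\mathbf S\mathbf u|,\qquad|\boldsymbol\sigma|\le p,\qquad\boldsymbol\sigma=\boldsymbol\sigma^{\intercal},\qquad\mathrm{tr}\,\boldsymbol\sigma=0$$ hold almost everywhere in $(0,T)\times\Omega$. -/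

import Mathlib

open MeasureTheory Filter Topology Set
open scoped ENNReal NNReal ContDiff Matrix

noncomputable section

namespace GranularFlow

/-- Three-dimensional Euclidean space. -/
abbrev E3 : Type := EuclideanSpace ℝ (Fin 3)

/-- Second-order tensors. -/
abbrev Tensor : Type := Matrix (Fin 3) (Fin 3) ℝ

/-! ### Tensor algebra -/

/-- The contraction `A : B = tr (Aᵀ B)`. -/
def contract (A B : Tensor) : ℝ := (Aᵀ * B).trace

/-- The tensor norm with the convention `|A|² = (1/2) A : A`. -/
def tnorm (A : Tensor) : ℝ := Real.sqrt ((1 / 2 : ℝ) * contract A A)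

/-- The matrix `(∂ⱼ uᵢ)` of a velocity gradient. -/
def gradMatrix (L : E3 →L[ℝ] E3) : Tensor :=
  Matrix.of fun i j => L (EuclideanSpace.single j (1 : ℝ)) i

/-- The divergence read off from the velocity gradient. -/
def divg (L : E3 →L[ℝ] E3) : ℝ := (gradMatrix L).trace

/-- The strain-rate tensor `D = (∇u + (∇u)ᵀ) / 2`. -/
def symg (L : E3 →L[ℝ] E3) : Tensor := (1 / 2 : ℝ) • (gradMatrix L + (gradMatrix L)ᵀ)

/-- The deviatoric strain-rate tensor `S = D - (1/3) (div u) I`. -/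
def devg (L : E3 →L[ℝ] E3) : Tensor := symg L - ((1 / 3 : ℝ) * divg L) • (1 : Tensor)

/-- The threshold relations between the stress `s`, the pressure `q` and the velocity
gradient `L` at one point:
`s : S = 2 q |S|`, `|s| ≤ q`, `s = sᵀ` and `tr s = 0`. -/
def ThresholdRelations (s : Tensor) (q : ℝ) (L : E3 →L[ℝ] E3) : Prop :=
  contract s (devg L) = 2 * q * tnorm (devg L) ∧ tnorm s ≤ q ∧ s = sᵀ ∧ s.trace = 0

/-! ### Function spaces -/

instance instFactOneLeThree : Fact ((1 : ℝ≥0∞) ≤ 3) := ⟨by norm_num⟩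

/-- The pairs `(φ, ∇φ)`, with `φ` a smooth vector field compactly supported in `Ω`, inside
`L³(Ω) × L³(Ω)`. -/
def testPairs (Ω : Set E3) :
    Submodule ℝ (Lp E3 3 (volume.restrict Ω) × Lp (E3 →L[ℝ] E3) 3 (volume.restrict Ω)) where
  carrier := {w | ∃ φ : E3 → E3, ContDiff ℝ ∞ φ ∧ HasCompactSupport φ ∧ tsupport φ ⊆ Ω ∧
    w.1 =ᵐ[volume.restrict Ω] φ ∧ w.2 =ᵐ[volume.restrict Ω] fderiv ℝ φ}
  zero_mem' := by
    refine ⟨0, contDiff_const, HasCompactSupport.zero, by simp [tsupport], ?_, ?_⟩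
    · exact Lp.coeFn_zero _ _ _
    · refine (Lp.coeFn_zero _ _ _).trans (Eventually.of_forall fun x => ?_)
      simp
  add_mem' := by
    rintro a b ⟨φ, hφ, cφ, sφ, a1, a2⟩ ⟨χ, hχ, cχ, sχ, b1, b2⟩
    refine ⟨φ + χ, hφ.add hχ, cφ.add cχ, (tsupport_add φ χ).trans (union_subset sφ sχ), ?_, ?_⟩
    · exact (Lp.coeFn_add _ _).trans (a1.add b1)
    · refine (Lp.coeFn_add _ _).trans ((a2.add b2).trans (Eventually.of_forall fun x => ?_))
      exact (fderiv_add (hφ.differentiable (by simp) x) (hχ.differentiable (by simp) x)).symm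
  smul_mem' := by
    rintro c a ⟨φ, hφ, cφ, sφ, a1, a2⟩
    refine ⟨c • φ, contDiff_const.smul hφ, cφ.smul_left (f := fun _ => c),
      (tsupport_smul_subset_right (fun _ => c) φ).trans sφ, ?_, ?_⟩
    · exact (Lp.coeFn_smul _ _).trans (a1.const_smul c)
    · refine (Lp.coeFn_smul _ _).trans ((a2.const_smul c).trans (Eventually.of_forall fun x => ?_))
      exact (fderiv_const_smul (hφ.differentiable (by simp) x) c).symm

/-- The Sobolev space `W₀^{1,3}(Ω)` of vector fields: the closure of the smooth compactly
supported fields for the norm of `W^{1,3}(Ω)`. An element is stored together with its weak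
gradient, which it determines. -/
def W₀ (Ω : Set E3) : Type := (testPairs Ω).topologicalClosure

instance instNormedAddCommGroupW₀ (Ω : Set E3) : NormedAddCommGroup (W₀ Ω) :=
  inferInstanceAs (NormedAddCommGroup (testPairs Ω).topologicalClosure)

instance instNormedSpaceW₀ (Ω : Set E3) : NormedSpace ℝ (W₀ Ω) :=
  inferInstanceAs (NormedSpace ℝ (testPairs Ω).topologicalClosure)

instance instCompleteSpaceW₀ (Ω : Set E3) : CompleteSpace (W₀ Ω) :=
  inferInstanceAs (CompleteSpace (testPairs Ω).topologicalClosure)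

/-- The dual `W^{-1,3/2}(Ω)` of `W₀^{1,3}(Ω)`. -/
abbrev WDual (Ω : Set E3) : Type := W₀ Ω →L[ℝ] ℝ

/-- The vector field underlying an element of `W₀^{1,3}(Ω)`. -/
def val {Ω : Set E3} (w : W₀ Ω) : E3 → E3 := w.1.1

/-- Its weak gradient. -/
def grad {Ω : Set E3} (w : W₀ Ω) : E3 → E3 →L[ℝ] E3 := w.1.2

/-- Lebesgue measure on the time interval `(0,T)`. -/
abbrev timeMeasure (T : ℝ) : Measure ℝ := volume.restrict (Ioo 0 T)

/-- Lebesgue measure on the cylinder `(0,T) × Ω`. -/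
abbrev cylMeasure (T : ℝ) (Ω : Set E3) : Measure (ℝ × E3) := volume.restrict (Ioo 0 T ×ˢ Ω)

/-- `g` is the derivative of `u` with respect to time, as a distribution on `(0,T)` with values
in `W^{-1,3/2}(Ω)`; vector fields act on `W₀^{1,3}(Ω)` by the `L²(Ω)` inner product. -/
def IsTimeDeriv (T : ℝ) (Ω : Set E3) (u : ℝ → W₀ Ω) (g : ℝ → WDual Ω) : Prop :=
  ∀ θ : ℝ → ℝ, ContDiff ℝ ∞ θ → HasCompactSupport θ → tsupport θ ⊆ Ioo 0 T → ∀ w : W₀ Ω,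
    ∫ t in Ioo 0 T, θ t * g t w =
      - ∫ t in Ioo 0 T, deriv θ t * ∫ x in Ω, inner ℝ (val (u t) x) (val w x)

/-- `u = v` at time `0`, in `L²(Ω)`: `u(t) → v` in `L²(Ω)` as `t → 0⁺`, `t` outside some null
set. -/
def HasInitialValue (T : ℝ) (Ω : Set E3) (u : ℝ → W₀ Ω) (v : E3 → E3) : Prop :=
  Tendsto (fun t => eLpNorm (fun x => val (u t) x - v x) 2 (volume.restrict Ω))
    (𝓝[Ioo 0 T] 0 ⊓ ae volume) (𝓝 0)

/-- `∫_Ω |u(T)|²`. As a class of functions of time, `u` has no value at `T` before its continuous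
representative in `C([0,T]; L²(Ω))` is chosen; the value of the energy of that representative at
`T` is the limit of `∫_Ω |u(t)|²` as `t → T⁻`, `t` outside some null set. It is written as a lower
limit, so that nothing about the existence of the limit is presupposed. -/
def finalEnergy (T : ℝ) (Ω : Set E3) (u : ℝ → W₀ Ω) : ℝ :=
  liminf (fun t => ∫ x in Ω, ‖val (u t) x‖ ^ 2) (𝓝[Ioo 0 T] T ⊓ ae volume)

/-! ### Weak solutions -/

/-- `(u, p, σ)` is a weak solution on `(0,T) × Ω`, for the force `f` and the initial velocity
`uinit`. -/
structure IsWeakSolution (T : ℝ) (Ω : Set E3) (uinit : E3 → E3) (f : ℝ → WDual Ω)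
    (u : ℝ → W₀ Ω) (p : ℝ × E3 → ℝ) (σ : ℝ × E3 → Tensor) : Prop where
  /-- `u ∈ L³(0,T; W₀^{1,3}(Ω))` -/
  u_memLp : MemLp u 3 (timeMeasure T)
  /-- `u ∈ L^∞(0,T; L²(Ω))` -/
  u_bounded : ∃ C : ℝ≥0, ∀ᵐ t ∂(timeMeasure T), eLpNorm (val (u t)) 2 (volume.restrict Ω) ≤ C
  /-- `p ∈ L^{3/2}((0,T) × Ω)` -/
  p_memLp : MemLp p (3 / 2) (cylMeasure T Ω)
  p_nonneg : ∀ᵐ z ∂(cylMeasure T Ω), 0 ≤ p z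
  /-- `σ ∈ L^{3/2}((0,T) × Ω)` -/
  stress_memLp : ∀ i j, MemLp (fun z => σ z i j) (3 / 2) (cylMeasure T Ω)
  stress_le : ∀ᵐ z ∂(cylMeasure T Ω), tnorm (σ z) ≤ p z
  stress_symm : ∀ᵐ z ∂(cylMeasure T Ω), σ z = (σ z)ᵀ
  stress_trace : ∀ᵐ z ∂(cylMeasure T Ω), (σ z).trace = 0
  /-- `∂ₜu ∈ L^{3/2}(0,T; W^{-1,3/2}(Ω))`, and the momentum equation. -/
  momentum : ∃ g : ℝ → WDual Ω, MemLp g (3 / 2) (timeMeasure T) ∧ IsTimeDeriv T Ω u g ∧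
    ∀ φ : ℝ → W₀ Ω, MemLp φ 3 (timeMeasure T) → ∀ᵐ t ∂(timeMeasure T),
      g t (φ t) - (∫ x in Ω, p (t, x) * divg (grad (φ t) x))
        + (∫ x in Ω, 2 * tnorm (symg (grad (u t) x)) *
            contract (symg (grad (u t) x)) (symg (grad (φ t) x)))
        + (∫ x in Ω, contract (σ (t, x)) (devg (grad (φ t) x)))
      = f t (φ t)
  /-- The weak form of the dilatancy law. -/
  dilatancy : ∀ ψ : ℝ × E3 → ℝ, MemLp ψ (3 / 2) (cylMeasure T Ω) → ∀ᵐ t ∂(timeMeasure T),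
      (∫ x in Ω, ψ (t, x) * divg (grad (u t) x))
        - (∫ x in Ω, 2 * ψ (t, x) * tnorm (devg (grad (u t) x)))
        + (∫ x in Ω, ψ (t, x) * Real.sqrt (p (t, x))) = 0
  /-- The energy inequality. -/
  energy :
    (1 / 2 : ℝ) * finalEnergy T Ω u
        + 4 * (∫ t in Ioo 0 T, ∫ x in Ω, tnorm (symg (grad (u t) x)) ^ 3)
        + (∫ t in Ioo 0 T, ∫ x in Ω, |p (t, x)| ^ (3 / 2 : ℝ))
      ≤ (1 / 2 : ℝ) * (∫ x in Ω, ‖uinit x‖ ^ 2) + ∫ t in Ioo 0 T, f t (u t)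
  initial : HasInitialValue T Ω u uinit

/-- `G` is a representative of the velocity gradient `∇u` that is measurable as a function of
`(t, x)`. -/
def IsSpaceTimeGradient (T : ℝ) (Ω : Set E3) (u : ℝ → W₀ Ω) (G : ℝ × E3 → E3 →L[ℝ] E3) : Prop :=
  AEStronglyMeasurable G (cylMeasure T Ω) ∧
    ∀ᵐ t ∂(timeMeasure T), ∀ᵐ x ∂(volume.restrict Ω), G (t, x) = grad (u t) x

end GranularFlow

end

/-!
At almost every point Cauchy–Schwarz (for the norm `|A|² = (1/2) A : A`) gives `σ : S ≤ 2 |σ| |S|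
≤ 2 p |S|`, so the *defect* `2 p |S u| - σ : S u` is nonnegative, and it is enough to show that its
integral over `(0,T) × Ω` is at most zero.

Testing the momentum equation with `u` and the dilatancy law with `p`, and adding, expresses the
integral of the defect over `Ω`, for almost every `t`, as
`⟨∂ₜu, u⟩ + 4 ∫ |D u|³ + ∫ p^{3/2} - ⟨f, u⟩` (`IsWeakSolution.ae_integral_defect`). After integration
over `(0,T)`, the energy inequality bounds this by zero as soon as
`∫₀ᵀ ⟨∂ₜu, u⟩ = (1/2) |u(T)|² - (1/2) |u_init|²` (`integral_timeDeriv_apply_self`).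

This balance is the Lions–Magenes lemma, proved here for a symmetric bounded bilinear form `B` on a
normed space `V` (`ae_bilin_eq_const_add_primitive`). By the du Bois-Reymond lemma, `B(u, ·)` is
almost everywhere a primitive of `g = ∂ₜu` with values in the dual of `V`. By symmetry,
`B(u(t+h), u(t+h)) - B(u(t), u(t)) = ∫₀ʰ g(t+τ)(u(t+h) + u(t)) dτ`; divided by `h`, the right-hand
side converges to `2 g(u)` in `L¹`, because translations are continuous in `Lᵖ` and `g`, `u` lie in
spaces with conjugate exponents. Hence `2 g(u)` is the distributional derivative of `B(u, u)`, and a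
second use of the du Bois-Reymond lemma shows that `B(u, u)` is almost everywhere a primitive of it.
Its limits at `0` and `T` are then the initial and the final energy.
-/

open MeasureTheory Filter Topology Set
open scoped ENNReal NNReal ContDiff Matrix

noncomputable section

namespace GranularFlow

/-! ### Functions with an integrable distributional derivative -/

/-- A test function of integral zero is the derivative of a test function. -/
theorem exists_contDiff_deriv_eq_of_integral_eq_zero {a b : ℝ} {η : ℝ → ℝ} (hη : ContDiff ℝ ∞ η)
    (hηc : HasCompactSupport η) (hηs : tsupport η ⊆ Ioo a b) (h0 : ∫ t, η t = 0) :
    ∃ θ : ℝ → ℝ, ContDiff ℝ ∞ θ ∧ HasCompactSupport θ ∧ tsupport θ ⊆ Ioo a b ∧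
      deriv θ = η := by
  rcases (tsupport η).eq_empty_or_nonempty with he | hne
  · have : η = 0 := tsupport_eq_empty_iff.mp he
    subst this
    exact ⟨0, contDiff_const, HasCompactSupport.zero, by simp [tsupport], by simp⟩
  obtain ⟨a', b', ha, hb, hK⟩ : ∃ a' b', a < a' ∧ b' < b ∧ tsupport η ⊆ Ioo a' b' := by
    obtain ⟨x, hx⟩ := hηc.exists_isLeast hne
    obtain ⟨y, hy⟩ := hηc.exists_isGreatest hne
    have h1 := (hηs hx.1).1
    have h2 := (hηs hy.1).2
    exact ⟨(a + x) / 2, (y + b) / 2, by linarith, by linarith,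
      fun z hz => ⟨by linarith [hx.2 hz], by linarith [hy.2 hz]⟩⟩
  have hηcont : Continuous η := hη.continuous
  have hzero : ∀ t, t ∉ Ioo a' b' → η t = 0 := fun t ht => image_eq_zero_of_notMem_tsupport
    fun h => ht (hK h)
  have hd : ∀ t, HasDerivAt (fun t => ∫ s in a'..t, η s) (η t) t := fun t =>
    intervalIntegral.integral_hasDerivAt_right (hηcont.intervalIntegrable _ _)
      (hηcont.stronglyMeasurableAtFilter _ _) hηcont.continuousAt
  have hderiv : deriv (fun t => ∫ s in a'..t, η s) = η := funext fun t => (hd t).deriv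
  have hsupp : ∀ t, t ∉ Icc a' b' → ∫ s in a'..t, η s = 0 := by
    intro t ht
    rcases lt_or_ge t a' with h | h
    · rw [intervalIntegral.integral_symm, intervalIntegral.integral_of_le h.le,
        setIntegral_congr_fun (g := fun _ => (0 : ℝ)) measurableSet_Ioc
          (fun s hs => hzero s fun h => absurd h.1 (not_lt.mpr hs.2))]
      simp
    · have hbt : b' < t := by
        by_contra hh
        exact ht ⟨h, not_lt.mp hh⟩
      rw [intervalIntegral.integral_eq_integral_of_support_subset, h0]
      intro s hs
      have hs' : s ∈ Ioo a' b' := by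
        by_contra hh
        exact hs (hzero s hh)
      exact ⟨hs'.1, hs'.2.le.trans hbt.le⟩
  have hts : tsupport (fun t => ∫ s in a'..t, η s) ⊆ Icc a' b' := by
    refine closure_minimal (fun t ht => ?_) isClosed_Icc
    by_contra hh
    exact ht (hsupp t hh)
  refine ⟨_, ?_, ?_, hts.trans fun t ht => ⟨ha.trans_le ht.1, ht.2.trans_lt hb⟩, hderiv⟩
  · rw [contDiff_infty_iff_deriv, hderiv]
    exact ⟨fun t => (hd t).differentiableAt, hη⟩
  · exact isCompact_Icc.of_isClosed_subset (isClosed_tsupport _) hts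

section Primitive

variable {E : Type*} [NormedAddCommGroup E] [NormedSpace ℝ E] [CompleteSpace E]

/-- **Du Bois-Reymond lemma**: a function whose distributional derivative vanishes is almost
everywhere constant. -/
theorem ae_eq_const_of_integral_deriv_smul_eq_zero {a b : ℝ} (hab : a < b) {h : ℝ → E}
    (hh : IntegrableOn h (Ioo a b))
    (hθ : ∀ θ : ℝ → ℝ, ContDiff ℝ ∞ θ → HasCompactSupport θ → tsupport θ ⊆ Ioo a b →
      ∫ t in Ioo a b, deriv θ t • h t = 0) :
    ∃ c : E, ∀ᵐ t ∂(volume.restrict (Ioo a b)), h t = c := by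
  obtain ⟨ρ, hρs, hρ, hρc, hρ1⟩ : ∃ ρ : ℝ → ℝ, tsupport ρ ⊆ Ioo a b ∧ ContDiff ℝ ∞ ρ ∧
      HasCompactSupport ρ ∧ ∫ t, ρ t = 1 := by
    let B : ContDiffBump ((a + b) / 2) := ⟨(b - a) / 8, (b - a) / 4, by linarith, by linarith⟩
    refine ⟨B.normed volume, ?_, B.contDiff_normed, B.hasCompactSupport_normed,
      B.integral_normed⟩
    rw [B.tsupport_normed_eq, Real.closedBall_eq_Icc]
    intro t ht
    have h1 : B.rOut = (b - a) / 4 := rfl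
    rw [h1] at ht
    exact ⟨by linarith [ht.1], by linarith [ht.2]⟩
  -- `η - (∫ η) ρ` has integral zero, hence is the derivative of a test function; this identifies
  -- the constant as `∫ ρ h`
  have key : ∀ η : ℝ → ℝ, ContDiff ℝ ∞ η → HasCompactSupport η → tsupport η ⊆ Ioo a b →
      ∫ t, η t • ((Ioo a b).indicator h t - ∫ s in Ioo a b, ρ s • h s) = 0 := by
    intro η hη hηc hηs
    have i1 : ∀ χ : ℝ → ℝ, ContDiff ℝ ∞ χ → HasCompactSupport χ →
        IntegrableOn (fun t => χ t • h t) (Ioo a b) := by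
      intro χ hχ hχc
      obtain ⟨C, hC⟩ := hχc.exists_bound_of_continuous hχ.continuous
      exact hh.bdd_smul C hχ.continuous.aestronglyMeasurable (Eventually.of_forall hC)
    have iη : Integrable η := hη.continuous.integrable_of_hasCompactSupport hηc
    have iρ : Integrable ρ := hρ.continuous.integrable_of_hasCompactSupport hρc
    obtain ⟨θ, h1, h2, h3, h4⟩ := exists_contDiff_deriv_eq_of_integral_eq_zero
      (η := η - (∫ t, η t) • ρ) (a := a) (b := b)
      (hη.sub (contDiff_const.smul hρ)) (hηc.sub (hρc.smul_left (f := fun _ => ∫ t, η t)))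
      ((tsupport_sub _ _).trans (union_subset hηs
        ((tsupport_smul_subset_right (fun _ => ∫ t, η t) ρ).trans hρs)))
      (by
        simp only [Pi.sub_apply, Pi.smul_apply]
        have iρ' : Integrable fun t => (∫ t, η t) • ρ t := iρ.const_mul _
        rw [integral_sub iη iρ', integral_smul, hρ1]; simp)
    have h5 := hθ θ h1 h2 h3
    rw [h4] at h5
    simp only [Pi.sub_apply, Pi.smul_apply, sub_smul, smul_assoc] at h5
    have i2 : IntegrableOn (fun t => (∫ t, η t) • ρ t • h t) (Ioo a b) := (i1 ρ hρ hρc).smul _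
    rw [integral_sub (i1 η hη hηc) i2, integral_smul] at h5
    have h6 : ∀ t, η t • (Ioo a b).indicator h t = (Ioo a b).indicator (fun t => η t • h t) t :=
      fun t => (indicator_smul_apply _ _ _ _).symm
    simp only [smul_sub, h6]
    rw [integral_sub ((integrable_indicator_iff measurableSet_Ioo).mpr (i1 η hη hηc))
      (iη.smul_const _), integral_indicator measurableSet_Ioo, integral_smul_const]
    exact h5
  have hloc : LocallyIntegrableOn
      (fun t => (Ioo a b).indicator h t - ∫ s in Ioo a b, ρ s • h s) (Ioo a b) volume := by
    refine (LocallyIntegrable.sub ?_ (locallyIntegrable_const _)).locallyIntegrableOn _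
    exact ((integrable_indicator_iff measurableSet_Ioo).mpr hh).locallyIntegrable
  refine ⟨∫ s in Ioo a b, ρ s • h s, ?_⟩
  rw [ae_restrict_iff' measurableSet_Ioo]
  filter_upwards [isOpen_Ioo.ae_eq_zero_of_integral_contDiff_smul_eq_zero hloc key] with t ht hm
  have := ht hm
  rwa [indicator_of_mem hm, sub_eq_zero] at this

/-- Integration by parts against the primitive of an integrable function. -/
theorem integral_deriv_mul_primitive {a b : ℝ} (hab : a < b) {γ : ℝ → ℝ}
    (hγ : IntegrableOn γ (Ioo a b)) {θ : ℝ → ℝ} (hθ : ContDiff ℝ ∞ θ)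
    (hθs : tsupport θ ⊆ Ioo a b) :
    ∫ t in Ioo a b, deriv θ t * ∫ s in a..t, γ s = - ∫ t in Ioo a b, θ t * γ t := by
  have hi : IntervalIntegrable γ volume a b := by
    rwa [intervalIntegrable_iff_integrableOn_Ioo_of_le hab.le]
  have hf : AbsolutelyContinuousOnInterval θ a b :=
    (hθ.of_le (by simp)).contDiffOn.absolutelyContinuousOnInterval
  have hg : AbsolutelyContinuousOnInterval (fun t => ∫ s in a..t, γ s) a b :=
    hi.absolutelyContinuousOnInterval_intervalIntegral (by simp)
  have ha : θ a = 0 := image_eq_zero_of_notMem_tsupport fun h => lt_irrefl _ (hθs h).1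
  have hb : θ b = 0 := image_eq_zero_of_notMem_tsupport fun h => lt_irrefl _ (hθs h).2
  have := hf.integral_mul_deriv_eq_deriv_mul hg
  rw [ha, hb] at this
  have h2 : ∫ t in a..b, θ t * deriv (fun t => ∫ s in a..t, γ s) t = ∫ t in a..b, θ t * γ t := by
    apply intervalIntegral.integral_congr_ae
    filter_upwards [hi.ae_hasDerivAt_integral] with t ht hm
    rw [(ht (uIoc_subset_uIcc hm) a (by simp)).deriv]
  rw [h2] at this
  rw [← integral_Ioc_eq_integral_Ioo, ← integral_Ioc_eq_integral_Ioo,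
    ← intervalIntegral.integral_of_le hab.le, ← intervalIntegral.integral_of_le hab.le, this]
  ring

/-- A function with an integrable distributional derivative is, up to a constant, the primitive
of that derivative. -/
theorem ae_eq_const_add_primitive {a b : ℝ} (hab : a < b) {v γ : ℝ → E}
    (hv : IntegrableOn v (Ioo a b)) (hγ : IntegrableOn γ (Ioo a b))
    (hθ : ∀ θ : ℝ → ℝ, ContDiff ℝ ∞ θ → HasCompactSupport θ → tsupport θ ⊆ Ioo a b →
      ∫ t in Ioo a b, deriv θ t • v t = - ∫ t in Ioo a b, θ t • γ t) :
    ∃ c : E, ∀ᵐ t ∂(volume.restrict (Ioo a b)), v t = c + ∫ s in a..t, γ s := by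
  have hi : IntervalIntegrable γ volume a b := by
    rwa [intervalIntegrable_iff_integrableOn_Ioo_of_le hab.le]
  have hcont : ContinuousOn (fun t => ∫ s in a..t, γ s) (Icc a b) := by
    have := intervalIntegral.continuousOn_primitive_interval' hi left_mem_uIcc
    rwa [uIcc_of_le hab.le] at this
  have hP : IntegrableOn (fun t => ∫ s in a..t, γ s) (Ioo a b) :=
    hcont.integrableOn_Icc.mono_set Ioo_subset_Icc_self
  obtain ⟨c, hc⟩ := ae_eq_const_of_integral_deriv_smul_eq_zero hab (hv.sub hP) (by
    intro θ h1 h2 h3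
    obtain ⟨C, hC⟩ := h2.deriv.exists_bound_of_continuous (h1.continuous_deriv (by simp))
    obtain ⟨C', hC'⟩ := h2.exists_bound_of_continuous h1.continuous
    have hdm : AEStronglyMeasurable (deriv θ) (volume.restrict (Ioo a b)) :=
      (h1.continuous_deriv (by simp)).aestronglyMeasurable
    have j1 : IntegrableOn (fun t => deriv θ t • v t) (Ioo a b) :=
      hv.bdd_smul C hdm (Eventually.of_forall hC)
    have j2 : IntegrableOn (fun t => deriv θ t • ∫ s in a..t, γ s) (Ioo a b) :=
      hP.bdd_smul C hdm (Eventually.of_forall hC)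
    have j3 : IntegrableOn (fun t => θ t • γ t) (Ioo a b) :=
      hγ.bdd_smul C' h1.continuous.aestronglyMeasurable (Eventually.of_forall hC')
    simp only [Pi.sub_apply, smul_sub]
    rw [integral_sub j1 j2, hθ θ h1 h2 h3, sub_eq_zero]
    -- the vector-valued integration by parts is tested against the dual
    refine (SeparatingDual.eq_iff_forall_dual_eq (R := ℝ)).mpr fun L => ?_
    rw [map_neg, ← L.integral_comp_comm j3, ← L.integral_comp_comm j2]
    have := integral_deriv_mul_primitive hab (L.integrable_comp hγ) h1 h3
    simp only [map_smul, smul_eq_mul]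
    rw [← this]
    refine setIntegral_congr_fun measurableSet_Ioo fun t ht => ?_
    rw [L.intervalIntegral_comp_comm]
    refine hi.mono_set ?_
    rw [uIcc_of_le ht.1.le, uIcc_of_le hab.le]
    exact Icc_subset_Icc_right ht.2.le)
  refine ⟨c, ?_⟩
  filter_upwards [hc] with t ht
  rw [← ht]; simp

end Primitive

/-! ### The chain rule for a quadratic form of a weakly differentiable function -/

/-- Translations act continuously on `Lᵖ(ℝ)`, `p < ∞`. -/
theorem tendsto_eLpNorm_translate_sub {E : Type*} [NormedAddCommGroup E] {p : ℝ≥0∞}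
    (hp1 : 1 ≤ p) (hp : p ≠ ⊤) {f : ℝ → E} (hf : MemLp f p volume) :
    Tendsto (fun τ : ℝ => eLpNorm (fun t => f (t + τ) - f t) p volume) (𝓝 0) (𝓝 0) := by
  have : Fact (1 ≤ p) := ⟨hp1⟩
  let G : ℝ → C(ℝ, ℝ) := fun τ => ⟨fun t => t + τ, by fun_prop⟩
  have hG : Continuous G :=
    (ContinuousMap.mk (fun z : ℝ × ℝ => z.2 + z.1) (by fun_prop)).curry.continuous
  have hmp : ∀ τ, MeasurePreserving (G τ) volume volume := fun τ =>
    measurePreserving_add_right volume τ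
  have h1 := (continuous_const (y := hf.toLp f)).compMeasurePreservingLp hG hmp hp
  have h2 := h1.tendsto 0
  rw [Lp.tendsto_Lp_iff_tendsto_eLpNorm'] at h2
  refine h2.congr fun τ => eLpNorm_congr_ae ?_
  have e1 : ∀ τ, (Lp.compMeasurePreserving (G τ) (hmp τ) (hf.toLp f) : ℝ → E)
      =ᵐ[volume] fun t => f (t + τ) := fun τ =>
    (Lp.coeFn_compMeasurePreserving _ (hmp τ)).trans
      ((hmp τ).quasiMeasurePreserving.ae_eq_comp hf.coeFn_toLp)
  filter_upwards [e1 τ, e1 0] with t h3 h4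
  simp only [Pi.sub_apply, h3, h4, add_zero]

section EnergyIdentity

variable {V : Type*} [NormedAddCommGroup V] [NormedSpace ℝ V]

theorem lintegral_enorm_apply_le {α : Type*} [MeasurableSpace α] {μ : Measure α} {p q : ℝ≥0∞}
    [ENNReal.HolderConjugate p q]
    {g : α → V →L[ℝ] ℝ} {u : α → V} (hg : AEStronglyMeasurable g μ)
    (hu : AEStronglyMeasurable u μ) :
    ∫⁻ t, ‖g t (u t)‖ₑ ∂μ ≤ eLpNorm g p μ * eLpNorm u q μ := by
  have := eLpNorm_le_eLpNorm_mul_eLpNorm_of_nnnorm (p := p) (q := q) (r := 1) hg hu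
    (fun L v => L v) 1 (Eventually.of_forall fun t => by
      simpa using (g t).le_opNNNorm (u t))
  simpa [eLpNorm_one_eq_lintegral_enorm] using this

theorem MemLp.integrable_apply {α : Type*} [MeasurableSpace α] {μ : Measure α} {p q : ℝ≥0∞}
    [ENNReal.HolderConjugate p q] {g : α → V →L[ℝ] ℝ} {u : α → V} (hg : MemLp g p μ)
    (hu : MemLp u q μ) : Integrable (fun t => g t (u t)) μ := by
  refine ⟨isBoundedBilinearMap_apply.continuous.comp_aestronglyMeasurable
    (hg.1.prodMk hu.1), ?_⟩
  exact (lintegral_enorm_apply_le hg.1 hu.1).trans_lt (ENNReal.mul_lt_top hg.2 hu.2)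

/-- The `L¹` distance between `g(· + τ)(u(· + h) + u)` and `2 g(u)` is controlled by the moduli of
continuity of `g` in `Lᵖ` and of `u` in `L^q`. -/
theorem lintegral_translate_apply_le {p q : ℝ≥0∞} [ENNReal.HolderConjugate p q] (hq : 1 ≤ q)
    {g : ℝ → V →L[ℝ] ℝ} {u : ℝ → V} (hg : MemLp g p volume) (hu : MemLp u q volume) (τ h : ℝ) :
    ∫⁻ t, ‖g (t + τ) (u (t + h) + u t) - 2 * g t (u t)‖ₑ ≤
      eLpNorm (fun t => g (t + τ) - g t) p volume * (2 * eLpNorm u q volume)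
        + eLpNorm g p volume * eLpNorm (fun t => u (t + h) - u t) q volume := by
  have mτ : AEStronglyMeasurable (fun t => g (t + τ)) volume :=
    hg.1.comp_measurePreserving (measurePreserving_add_right volume τ)
  have mh : AEStronglyMeasurable (fun t => u (t + h)) volume :=
    hu.1.comp_measurePreserving (measurePreserving_add_right volume h)
  have e1 : eLpNorm (fun t => u (t + h)) q volume = eLpNorm u q volume :=
    eLpNorm_comp_measurePreserving hu.1 (measurePreserving_add_right volume h)
  calc ∫⁻ t, ‖g (t + τ) (u (t + h) + u t) - 2 * g t (u t)‖ₑ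
      = ∫⁻ t, ‖(g (t + τ) - g t) (u (t + h) + u t) + g t (u (t + h) - u t)‖ₑ := by
        refine lintegral_congr fun t => ?_
        congr 1
        simp only [map_add, map_sub, sub_apply]
        ring
    _ ≤ ∫⁻ t, (‖(g (t + τ) - g t) (u (t + h) + u t)‖ₑ + ‖g t (u (t + h) - u t)‖ₑ) :=
        lintegral_mono fun t => enorm_add_le _ _
    _ = (∫⁻ t, ‖(g (t + τ) - g t) (u (t + h) + u t)‖ₑ) + ∫⁻ t, ‖g t (u (t + h) - u t)‖ₑ := by
        refine lintegral_add_left' (f := fun t => ‖(g (t + τ) - g t) (u (t + h) + u t)‖ₑ) ?_ _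
        exact (isBoundedBilinearMap_apply.continuous.comp_aestronglyMeasurable
          ((mτ.sub hg.1).prodMk (mh.add hu.1))).enorm
    _ ≤ eLpNorm (fun t => g (t + τ) - g t) p volume *
          eLpNorm (fun t => u (t + h) + u t) q volume
        + eLpNorm g p volume * eLpNorm (fun t => u (t + h) - u t) q volume :=
        add_le_add (lintegral_enorm_apply_le (g := fun t => g (t + τ) - g t)
            (u := fun t => u (t + h) + u t) (mτ.sub hg.1) (mh.add hu.1))
          (lintegral_enorm_apply_le (u := fun t => u (t + h) - u t) hg.1 (mh.sub hu.1))
    _ ≤ _ := by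
        gcongr
        refine (eLpNorm_add_le mh hu.1 hq).trans ?_
        rw [e1, two_mul]

/-- Averages over `τ ∈ (0, h)` of `g(· + τ)(u(· + h) + u)` converge to `2 g(u)` in `L¹`, hence
when tested against a bounded function. -/
theorem tendsto_integral_average {p q : ℝ≥0∞} [ENNReal.HolderConjugate p q] (hp1 : 1 ≤ p)
    (hp : p ≠ ⊤) (hq1 : 1 ≤ q) (hq : q ≠ ⊤) {g : ℝ → V →L[ℝ] ℝ} {u : ℝ → V}
    (hgm : StronglyMeasurable g) (hum : StronglyMeasurable u)
    (hg : MemLp g p volume) (hu : MemLp u q volume) {η : ℝ → ℝ} {C : ℝ≥0}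
    (hC : ∀ t, ‖η t‖ₑ ≤ C) :
    Tendsto (fun h : ℝ => ∫ t, η t *
      (h⁻¹ * ∫ τ in Ioc 0 h, (g (t + τ) (u (t + h) + u t) - 2 * g t (u t)))) (𝓝[>] 0) (𝓝 0) := by
  rw [tendsto_zero_iff_enorm_tendsto_zero]
  set G := eLpNorm g p volume with hG
  set U := eLpNorm u q volume with hU
  set K : ℝ≥0∞ := C * (2 * U + G) with hK
  have hKtop : K ≠ ⊤ := by
    refine ENNReal.mul_ne_top ENNReal.coe_ne_top (ENNReal.add_ne_top.mpr ⟨?_, hg.2.ne⟩)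
    exact ENNReal.mul_ne_top (by simp) hu.2.ne
  rw [ENNReal.tendsto_nhds_zero]
  intro ε hε
  set δ := ε / (K + 1) with hδ
  have hδ0 : 0 < δ := ENNReal.div_pos hε.ne' (by finiteness)
  have hδε : K * δ ≤ ε := by
    calc K * δ ≤ (K + 1) * δ := by gcongr; exact le_self_add
      _ ≤ ε := ENNReal.mul_div_le
  have t1 := ENNReal.tendsto_nhds_zero.mp (tendsto_eLpNorm_translate_sub hp1 hp hg) δ hδ0
  have t2 := ENNReal.tendsto_nhds_zero.mp (tendsto_eLpNorm_translate_sub hq1 hq hu) δ hδ0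
  obtain ⟨r, hr, hball⟩ := Metric.eventually_nhds_iff.mp (t1.and t2)
  filter_upwards [Ioo_mem_nhdsGT hr] with h hh
  have hh0 : 0 < h := hh.1
  have hsmall : ∀ τ ∈ Ioc 0 h, ∫⁻ t, ‖g (t + τ) (u (t + h) + u t) - 2 * g t (u t)‖ₑ ≤
      δ * (2 * U + G) := by
    intro τ hτ
    refine (lintegral_translate_apply_le hq1 hg hu τ h).trans ?_
    have a1 := (hball (y := τ) (by
      rw [Real.dist_eq, sub_zero, abs_of_pos hτ.1]; exact hτ.2.trans_lt hh.2)).1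
    have a2 := (hball (y := h) (by
      rw [Real.dist_eq, sub_zero, abs_of_pos hh0]; exact hh.2)).2
    rw [mul_add, mul_comm δ G]
    gcongr
  have hmeas : StronglyMeasurable fun z : ℝ × ℝ =>
      g (z.1 + z.2) (u (z.1 + h) + u z.1) - 2 * g z.1 (u z.1) := by
    have m1 : StronglyMeasurable fun z : ℝ × ℝ => g (z.1 + z.2) :=
      hgm.comp_measurable (by fun_prop)
    have m2 : StronglyMeasurable fun z : ℝ × ℝ => u (z.1 + h) :=
      hum.comp_measurable (by fun_prop)
    have m3 : StronglyMeasurable fun z : ℝ × ℝ => u z.1 := hum.comp_measurable (by fun_prop)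
    have m4 : StronglyMeasurable fun z : ℝ × ℝ => g z.1 := hgm.comp_measurable (by fun_prop)
    have c := (isBoundedBilinearMap_apply (𝕜 := ℝ) (E := V) (F := ℝ)).continuous
    exact (c.comp_stronglyMeasurable (m1.prodMk (m2.add m3))).sub
      ((c.comp_stronglyMeasurable (m4.prodMk m3)).const_mul 2)
  calc ‖∫ t, η t * (h⁻¹ * ∫ τ in Ioc 0 h,
          (g (t + τ) (u (t + h) + u t) - 2 * g t (u t)))‖ₑ
      ≤ ∫⁻ t, ‖η t * (h⁻¹ * ∫ τ in Ioc 0 h,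
          (g (t + τ) (u (t + h) + u t) - 2 * g t (u t)))‖ₑ := enorm_integral_le_lintegral_enorm _
    _ ≤ ∫⁻ t, (C * ‖h⁻¹‖ₑ) * ∫⁻ τ in Ioc 0 h,
          ‖g (t + τ) (u (t + h) + u t) - 2 * g t (u t)‖ₑ := by
        refine lintegral_mono fun t => ?_
        rw [enorm_mul, enorm_mul, mul_assoc]
        gcongr
        · exact hC t
        · exact enorm_integral_le_lintegral_enorm _
    _ = (C * ‖h⁻¹‖ₑ) * ∫⁻ t, ∫⁻ τ in Ioc 0 h,
          ‖g (t + τ) (u (t + h) + u t) - 2 * g t (u t)‖ₑ :=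
        lintegral_const_mul' _ _ (by finiteness)
    _ = (C * ‖h⁻¹‖ₑ) * ∫⁻ τ in Ioc 0 h, ∫⁻ t,
          ‖g (t + τ) (u (t + h) + u t) - 2 * g t (u t)‖ₑ := by
        rw [lintegral_lintegral_swap]
        exact hmeas.enorm.aemeasurable
    _ ≤ (C * ‖h⁻¹‖ₑ) * ∫⁻ τ in Ioc 0 h, δ * (2 * U + G) := by
        refine mul_le_mul_right ?_ _
        exact setLIntegral_mono measurable_const hsmall
    _ = (‖h⁻¹‖ₑ * ENNReal.ofReal h) * (K * δ) := by
        rw [lintegral_const, Measure.restrict_apply_univ, Real.volume_Ioc, sub_zero, hK]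
        ring
    _ = K * δ := by
        rw [Real.enorm_of_nonneg (inv_nonneg.mpr hh0.le),
          ← ENNReal.ofReal_mul (inv_nonneg.mpr hh0.le), inv_mul_cancel₀ hh0.ne']
        simp
    _ ≤ ε := hδε

/-- The distributional chain rule `(B(u, u))' = 2 g(u)`, where `g` is the derivative of
`B(u, ·)`. -/
theorem integral_deriv_mul_bilin {p q : ℝ≥0∞} [ENNReal.HolderConjugate p q] (hp1 : 1 ≤ p)
    (hp : p ≠ ⊤) (hq1 : 1 ≤ q) (hq : q ≠ ⊤) {a b : ℝ} {B : V →L[ℝ] V →L[ℝ] ℝ}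
    (hB : ∀ v w, B v w = B w v) {g : ℝ → V →L[ℝ] ℝ} {u : ℝ → V}
    (hgm : StronglyMeasurable g) (hum : StronglyMeasurable u)
    (hg : MemLp g p volume) (hu : MemLp u q volume)
    (hBu : Integrable (fun t => B (u t) (u t)) volume) {c : V →L[ℝ] ℝ}
    (hder : ∀ᵐ t, t ∈ Ioo a b → B (u t) = c + ∫ s in a..t, g s)
    {η : ℝ → ℝ} (hη : ContDiff ℝ ∞ η) (hηc : HasCompactSupport η) (hηs : tsupport η ⊆ Ioo a b) :
    ∫ t, deriv η t * B (u t) (u t) = - ∫ t, η t * (2 * g t (u t)) := by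
  obtain ⟨C, hC⟩ := hηc.exists_bound_of_continuous hη.continuous
  have hC' : ∀ t, ‖η t‖ₑ ≤ C.toNNReal := fun t => by
    rw [← ofReal_norm]
    exact ENNReal.ofReal_le_ofReal (hC t)
  obtain ⟨L, hL⟩ : ∃ L : ℝ≥0, LipschitzWith L η :=
    (hη.of_le (m := 1) (by simp)).lipschitzWith_of_hasCompactSupport hηc one_ne_zero
  have hgu : Integrable (fun t => g t (u t)) volume := MemLp.integrable_apply hg hu
  have hηgu : Integrable (fun t => η t * (2 * g t (u t))) volume :=
    (hgu.const_mul 2).bdd_mul hη.continuous.aestronglyMeasurable (Eventually.of_forall hC)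
  have hηe : ∀ h : ℝ, Integrable (fun t => η t * B (u (t + h)) (u (t + h))) volume := fun h =>
    (hBu.comp_add_right h).bdd_mul hη.continuous.aestronglyMeasurable (Eventually.of_forall hC)
  -- the difference quotients of the test function
  have lim1 : Tendsto (fun h : ℝ => ∫ t, (h⁻¹ * (η (t - h) - η t)) * B (u t) (u t)) (𝓝[>] 0)
      (𝓝 (∫ t, (- deriv η t) * B (u t) (u t))) := by
    refine tendsto_integral_filter_of_dominated_convergence
      (fun t => L * ‖B (u t) (u t)‖) ?_ ?_ (hBu.norm.const_mul _) ?_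
    · refine Eventually.of_forall fun h => ?_
      have : Continuous fun t => h⁻¹ * (η (t - h) - η t) := by
        have := hη.continuous
        fun_prop
      exact this.aestronglyMeasurable.mul hBu.1
    · filter_upwards [self_mem_nhdsWithin] with h hh
      refine Eventually.of_forall fun t => ?_
      have hh : 0 < h := hh
      rw [norm_mul]
      gcongr
      have := hL.dist_le_mul (t - h) t
      rw [Real.dist_eq, Real.dist_eq, sub_sub_cancel_left, abs_neg, abs_of_pos hh] at this
      rw [norm_mul, norm_inv, Real.norm_eq_abs, Real.norm_eq_abs, abs_of_pos hh,
        inv_mul_le_iff₀ hh]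
      linarith
    · refine Eventually.of_forall fun t => ?_
      refine Tendsto.mul_const _ ?_
      have hd : HasDerivAt (fun h => η (t - h)) (-deriv η t) 0 := by
        have h1 : HasDerivAt η (deriv η t) (t - 0) := by
          rw [sub_zero]; exact (hη.differentiable (by simp) t).hasDerivAt
        simpa [Function.comp_def] using! h1.comp (0 : ℝ) ((hasDerivAt_id (0 : ℝ)).const_sub t)
      have := hd.tendsto_slope_zero_right
      simpa using this
  -- the difference quotients of `B(u, u)`
  have lim2 : Tendsto (fun h : ℝ => ∫ t, (h⁻¹ * (η (t - h) - η t)) * B (u t) (u t)) (𝓝[>] 0)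
      (𝓝 (∫ t, η t * (2 * g t (u t)))) := by
    rw [← tendsto_sub_nhds_zero_iff]
    refine (tendsto_integral_average hp1 hp hq1 hq hgm hum hg hu hC').congr' ?_
    obtain ⟨r, hr, hrs⟩ : ∃ r > 0, ∀ t ∈ tsupport η, ∀ h ∈ Ioo 0 r, t + h ∈ Ioo a b := by
      obtain ⟨r, hr, hrs⟩ := hηc.isCompact.exists_thickening_subset_open isOpen_Ioo hηs
      refine ⟨r, hr, fun t ht h hh => hrs (Metric.mem_thickening_iff.mpr ⟨t, ht, ?_⟩)⟩
      rw [Real.dist_eq, add_sub_cancel_left, abs_of_pos hh.1]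
      exact hh.2
    filter_upwards [Ioo_mem_nhdsGT hr] with h hh
    have hh0 : 0 < h := hh.1
    -- a translation moves the difference quotient from the test function to `B(u, u)`
    have shift : ∫ t, (h⁻¹ * (η (t - h) - η t)) * B (u t) (u t)
        = ∫ t, η t * (h⁻¹ * (B (u (t + h)) (u (t + h)) - B (u t) (u t))) := by
      have i0 := hηe 0
      simp only [add_zero] at i0
      have i1 : Integrable (fun t => η (t - h) * B (u t) (u t)) volume := by
        simpa using (hηe h).comp_sub_right h
      calc ∫ t, (h⁻¹ * (η (t - h) - η t)) * B (u t) (u t)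
          = h⁻¹ * (∫ t, (η (t - h) * B (u t) (u t) - η t * B (u t) (u t))) := by
            rw [← integral_const_mul]
            exact integral_congr_ae (Eventually.of_forall fun t => by ring)
        _ = h⁻¹ * (∫ t, (η t * B (u (t + h)) (u (t + h)) - η t * B (u t) (u t))) := by
            rw [integral_sub i1 i0, integral_sub (hηe h) i0]
            rw [← integral_add_right_eq_self (fun t => η (t - h) * B (u t) (u t)) h]
            simp
        _ = _ := by
            rw [← integral_const_mul]
            exact integral_congr_ae (Eventually.of_forall fun t => by ring)
    have iq : Integrable
        (fun t => η t * (h⁻¹ * (B (u (t + h)) (u (t + h)) - B (u t) (u t)))) volume := by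
      have := ((hηe h).sub (hηe 0)).const_mul h⁻¹
      refine this.congr (Eventually.of_forall fun t => ?_)
      simp only [Pi.sub_apply, add_zero]
      ring
    rw [shift, ← integral_sub iq hηgu]
    refine integral_congr_ae ?_
    have hder' : ∀ᵐ t, t + h ∈ Ioo a b → B (u (t + h)) = c + ∫ s in a..(t + h), g s :=
      (measurePreserving_add_right volume h).quasiMeasurePreserving.ae hder
    have hgi : ∀ x y, IntervalIntegrable g volume x y := fun x y =>
      intervalIntegrable_iff.mpr (((hg.locallyIntegrable hp1).integrableOn_isCompact
        isCompact_uIcc).mono_set uIoc_subset_uIcc)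
    filter_upwards [hder, hder'] with t ht1 ht2
    by_cases h0 : η t = 0
    · simp [h0]
    have hts : t ∈ tsupport η := subset_tsupport _ h0
    have e1 := ht1 (hηs hts)
    have e2 := ht2 (hrs t hts h hh)
    have e3 : B (u (t + h)) - B (u t) = ∫ τ in Ioc 0 h, g (t + τ) := by
      rw [e1, e2, add_sub_add_left_eq_sub, intervalIntegral.integral_interval_sub_left
        (hgi _ _) (hgi _ _), ← intervalIntegral.integral_of_le hh0.le,
        intervalIntegral.integral_comp_add_left]
      simp
    have hgτ : IntegrableOn (fun τ => g (t + τ)) (Ioc 0 h) volume := by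
      have := (hgi (t + 0) (t + h)).comp_add_left t
      rw [add_sub_cancel_left, add_sub_cancel_left] at this
      exact (intervalIntegrable_iff_integrableOn_Ioc_of_le hh0.le).mp this
    -- symmetry of `B`: `B(v, v) - B(w, w) = B(v - w, v + w)`
    have e4 : B (u (t + h)) (u (t + h)) - B (u t) (u t)
        = ∫ τ in Ioc 0 h, g (t + τ) (u (t + h) + u t) := by
      rw [← ContinuousLinearMap.integral_apply hgτ, ← e3]
      simp only [map_add, sub_apply]
      rw [hB (u t) (u (t + h))]
      ring
    rw [e4, integral_sub (hgτ.apply_continuousLinearMap _) (integrable_const _),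
      setIntegral_const, Real.volume_real_Ioc_of_le hh0.le]
    simp only [smul_eq_mul, sub_zero]
    field_simp
  have := tendsto_nhds_unique lim1 lim2
  simp only [neg_mul] at this
  rw [integral_neg] at this
  linarith

/-- A function in `Lᵖ(s)` has a strongly measurable representative defined everywhere and zero
outside `s`; the translates of the latter make sense. -/
theorem exists_stronglyMeasurable_extension {α E : Type*} [MeasurableSpace α] {μ : Measure α}
    [NormedAddCommGroup E] {p : ℝ≥0∞} {s : Set α} (hs : MeasurableSet s) {f : α → E}
    (hf : MemLp f p (μ.restrict s)) :
    ∃ f' : α → E, StronglyMeasurable f' ∧ MemLp f' p μ ∧ f =ᵐ[μ.restrict s] f' ∧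
      ∀ t ∉ s, f' t = 0 := by
  refine ⟨s.indicator (hf.1.mk f), hf.1.stronglyMeasurable_mk.indicator hs,
    (memLp_indicator_iff_restrict hs).mpr (hf.ae_eq hf.1.ae_eq_mk), ?_,
    fun t ht => indicator_of_notMem ht _⟩
  exact hf.1.ae_eq_mk.trans (indicator_ae_eq_restrict hs).symm

/-- **Lions–Magenes energy identity**: if `u ∈ L^q(a,b;V)` and the derivative `g` of `B(u, ·)` lies
in `Lᵖ(a,b;V')`, with conjugate exponents, then `B(u, u)` is almost everywhere equal to a
primitive of `2 g(u)`. -/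
theorem ae_bilin_eq_const_add_primitive {p q : ℝ≥0∞} [ENNReal.HolderConjugate p q] (hp1 : 1 ≤ p)
    (hp : p ≠ ⊤) (hq2 : 2 ≤ q) (hq : q ≠ ⊤) {a b : ℝ} (hab : a < b) {B : V →L[ℝ] V →L[ℝ] ℝ}
    (hB : ∀ v w, B v w = B w v) {g : ℝ → V →L[ℝ] ℝ} {u : ℝ → V}
    (hg : MemLp g p (volume.restrict (Ioo a b))) (hu : MemLp u q (volume.restrict (Ioo a b)))
    (hder : ∀ θ : ℝ → ℝ, ContDiff ℝ ∞ θ → HasCompactSupport θ → tsupport θ ⊆ Ioo a b → ∀ w : V,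
      ∫ t in Ioo a b, θ t * g t w = - ∫ t in Ioo a b, deriv θ t * B (u t) w) :
    ∃ c : ℝ, ∀ᵐ t ∂(volume.restrict (Ioo a b)),
      B (u t) (u t) = c + ∫ s in a..t, 2 * g s (u s) := by
  have hq1 : 1 ≤ q := le_trans (by norm_num) hq2
  obtain ⟨u0, hum, hu0, hue, huz⟩ := exists_stronglyMeasurable_extension measurableSet_Ioo hu
  obtain ⟨g0, hgm, hg0, hge, -⟩ := exists_stronglyMeasurable_extension measurableSet_Ioo hg
  have hui : IntegrableOn u0 (Ioo a b) := (hu0.restrict (Ioo a b)).integrable hq1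
  have hgi : IntegrableOn g0 (Ioo a b) := (hg0.restrict (Ioo a b)).integrable hp1
  have hguI : Integrable (fun t => 2 * g0 t (u0 t)) volume :=
    (MemLp.integrable_apply hg0 hu0).const_mul 2
  have hBu : Integrable (fun t => B (u0 t) (u0 t)) volume := by
    have h2 : MemLp u0 2 (volume.restrict (Ioo a b)) :=
      (hu0.restrict (Ioo a b)).mono_exponent hq2
    have h3 : IntegrableOn (fun t => B (u0 t) (u0 t)) (Ioo a b) :=
      MemLp.integrable_apply (p := 2) (q := 2) (B.comp_memLp' h2) h2
    rw [← integrableOn_univ]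
    refine h3.of_forall_sdiff_eq_zero MeasurableSet.univ fun t ht => ?_
    simp [huz t ht.2]
  obtain ⟨c, hc⟩ := ae_eq_const_add_primitive hab (v := fun t => B (u0 t)) (γ := g0)
    (B.integrable_comp hui) hgi (by
      intro θ h1 h2 h3
      obtain ⟨C, hC⟩ := h2.deriv.exists_bound_of_continuous (h1.continuous_deriv (by simp))
      obtain ⟨C', hC'⟩ := h2.exists_bound_of_continuous h1.continuous
      have j1 : IntegrableOn (fun t => deriv θ t • B (u0 t)) (Ioo a b) :=
        (B.integrable_comp hui).bdd_smul C
          (h1.continuous_deriv (by simp)).aestronglyMeasurable (Eventually.of_forall hC)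
      have j2 : IntegrableOn (fun t => θ t • g0 t) (Ioo a b) :=
        hgi.bdd_smul C' h1.continuous.aestronglyMeasurable (Eventually.of_forall hC')
      ext w
      rw [neg_apply, ContinuousLinearMap.integral_apply j1,
        ContinuousLinearMap.integral_apply j2]
      have e1 : ∫ t in Ioo a b, (θ t • g0 t) w = ∫ t in Ioo a b, θ t * g t w :=
        integral_congr_ae (by filter_upwards [hge] with t ht; simp [ht])
      have e2 : ∫ t in Ioo a b, (deriv θ t • B (u0 t)) w
          = ∫ t in Ioo a b, deriv θ t * B (u t) w :=
        integral_congr_ae (by filter_upwards [hue] with t ht; simp [ht])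
      rw [e1, e2, hder θ h1 h2 h3 w, neg_neg])
  rw [ae_restrict_iff' measurableSet_Ioo] at hc
  obtain ⟨c', hc'⟩ := ae_eq_const_add_primitive hab (v := fun t => B (u0 t) (u0 t))
    (γ := fun t => 2 * g0 t (u0 t)) hBu.integrableOn hguI.integrableOn (by
      intro θ h1 h2 h3
      have key := integral_deriv_mul_bilin hp1 hp hq1 hq hB hgm hum hg0 hu0 hBu hc h1 h2 h3
      simp only [smul_eq_mul]
      rw [setIntegral_eq_integral_of_forall_compl_eq_zero, key,
        setIntegral_eq_integral_of_forall_compl_eq_zero]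
      · intro t ht
        rw [image_eq_zero_of_notMem_tsupport fun h => ht (h3 h), zero_mul]
      · intro t ht
        rw [image_eq_zero_of_notMem_tsupport fun h => ht (h3 (tsupport_deriv_subset h)),
          zero_mul])
  refine ⟨c', ?_⟩
  filter_upwards [hc', hue, ae_restrict_mem measurableSet_Ioo] with t h1 h2 h3
  rw [h2, h1]
  congr 1
  rw [intervalIntegral.integral_of_le h3.1.le, intervalIntegral.integral_of_le h3.1.le]
  refine setIntegral_congr_ae measurableSet_Ioc ?_
  rw [EventuallyEq, ae_restrict_iff' measurableSet_Ioo] at hue hge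
  filter_upwards [hue, hge] with s h4 h5 h6
  have : s ∈ Ioo a b := ⟨h6.1, h6.2.trans_lt h3.2⟩
  rw [h4 this, h5 this]

end EnergyIdentity

/-! ### Tensor algebra -/

theorem contract_eq_sum (A B : Tensor) : contract A B = ∑ i, ∑ j, A j i * B j i := by
  simp [contract, Matrix.trace, Matrix.mul_apply]

theorem contract_self_nonneg (A : Tensor) : 0 ≤ contract A A := by
  rw [contract_eq_sum]
  exact Finset.sum_nonneg fun i _ => Finset.sum_nonneg fun j _ => mul_self_nonneg _

theorem contract_self (A : Tensor) : contract A A = 2 * tnorm A ^ 2 := by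
  rw [tnorm, Real.sq_sqrt (mul_nonneg (by norm_num) (contract_self_nonneg A))]
  ring

theorem tnorm_nonneg (A : Tensor) : 0 ≤ tnorm A := Real.sqrt_nonneg _

/-- The tensor norm is Euclidean, so that Cauchy–Schwarz holds; the factor `2` comes from
`|A|² = (1/2) A : A`. -/
theorem contract_le (A B : Tensor) : contract A B ≤ 2 * tnorm A * tnorm B := by
  have h : contract A B ^ 2 ≤ contract A A * contract B B := by
    simp only [contract_eq_sum, ← Fintype.sum_prod_type' fun i j => _ * _]
    have := Finset.sum_mul_sq_le_sq_mul_sq Finset.univ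
      (fun z : Fin 3 × Fin 3 => A z.2 z.1) (fun z => B z.2 z.1)
    simpa only [sq] using this
  rw [contract_self, contract_self] at h
  refine le_of_sq_le_sq ?_ (by have := tnorm_nonneg A; have := tnorm_nonneg B; positivity)
  linarith

/-- The entries of a tensor as a vector of a Euclidean space, rescaled by `1/√2` so that its norm is
the tensor norm. -/
def euclidOfTensor : Tensor →ₗ[ℝ] EuclideanSpace ℝ (Fin 3 × Fin 3) where
  toFun A := WithLp.toLp 2 fun z => (Real.sqrt 2)⁻¹ * A z.2 z.1
  map_add' A B := by ext z; simp [mul_add]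
  map_smul' c A := by ext z; simp [mul_left_comm]

theorem norm_euclidOfTensor (A : Tensor) : ‖euclidOfTensor A‖ = tnorm A := by
  rw [EuclideanSpace.norm_eq, tnorm, contract_eq_sum, Fintype.sum_prod_type]
  congr 1
  simp only [euclidOfTensor, LinearMap.coe_mk, AddHom.coe_mk, Real.norm_eq_abs, sq_abs, mul_pow,
    inv_pow, Real.sq_sqrt zero_le_two, Finset.mul_sum]
  norm_num [sq]

/-- `gradMatrix` as a linear map. -/
def gradMatrixₗ : (E3 →L[ℝ] E3) →ₗ[ℝ] Tensor where
  toFun := gradMatrix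
  map_add' L M := by ext i j; simp [gradMatrix]
  map_smul' c L := by ext i j; simp [gradMatrix]

/-- `divg` as a linear map. -/
def divgₗ : (E3 →L[ℝ] E3) →ₗ[ℝ] ℝ := Matrix.traceLinearMap (Fin 3) ℝ ℝ ∘ₗ gradMatrixₗ

/-- `symg` as a linear map. -/
def symgₗ : (E3 →L[ℝ] E3) →ₗ[ℝ] Tensor :=
  (1 / 2 : ℝ) • (gradMatrixₗ + (Matrix.transposeLinearEquiv (Fin 3) (Fin 3) ℝ ℝ).toLinearMap ∘ₗ
    gradMatrixₗ)

/-- `devg` as a linear map. -/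
def devgₗ : (E3 →L[ℝ] E3) →ₗ[ℝ] Tensor :=
  symgₗ - ((1 / 3 : ℝ) • divgₗ).smulRight (1 : Tensor)

/-- `symg` with values in a Euclidean space whose norm is the tensor norm. -/
def symgL : (E3 →L[ℝ] E3) →L[ℝ] EuclideanSpace ℝ (Fin 3 × Fin 3) :=
  LinearMap.toContinuousLinearMap (euclidOfTensor ∘ₗ symgₗ)

/-- `devg` with values in a Euclidean space whose norm is the tensor norm. -/
def devgL : (E3 →L[ℝ] E3) →L[ℝ] EuclideanSpace ℝ (Fin 3 × Fin 3) :=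
  LinearMap.toContinuousLinearMap (euclidOfTensor ∘ₗ devgₗ)

theorem norm_symgL (L : E3 →L[ℝ] E3) : ‖symgL L‖ = tnorm (symg L) := norm_euclidOfTensor _

theorem norm_devgL (L : E3 →L[ℝ] E3) : ‖devgL L‖ = tnorm (devg L) := norm_euclidOfTensor _

/-- The entries of `devg` as continuous linear forms. -/
def devgEntryL (i j : Fin 3) : (E3 →L[ℝ] E3) →L[ℝ] ℝ :=
  LinearMap.toContinuousLinearMap (Matrix.entryLinearMap ℝ ℝ i j ∘ₗ devgₗ)

theorem devgEntryL_apply (i j : Fin 3) (L : E3 →L[ℝ] E3) : devgEntryL i j L = devg L i j := rfl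

/-! ### The Sobolev space and its pairing -/

variable {Ω : Set E3}

/-- The inclusion of `W₀^{1,3}(Ω)` in `L³(Ω) × L³(Ω)`. -/
def pairL (Ω : Set E3) :
    W₀ Ω →L[ℝ] Lp E3 3 (volume.restrict Ω) × Lp (E3 →L[ℝ] E3) 3 (volume.restrict Ω) :=
  (testPairs Ω).topologicalClosure.subtypeL

theorem memLp_grad (w : W₀ Ω) : MemLp (grad w) 3 (volume.restrict Ω) := Lp.memLp _

section LpInclusion

variable {α E : Type*} [MeasurableSpace α] [NormedAddCommGroup E]

theorem memLp_two_of_lp_three {μ : Measure α} [IsFiniteMeasure μ] (f : Lp E 3 μ) :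
    MemLp f 2 μ := (Lp.memLp f).mono_exponent (by norm_num)

variable [NormedSpace ℝ E]

/-- The inclusion `L³ ⊆ L²` on a space of finite measure. -/
def lpInclusion (μ : Measure α) [IsFiniteMeasure μ] : Lp E 3 μ →L[ℝ] Lp E 2 μ :=
  LinearMap.mkContinuous
    { toFun := fun f => (memLp_two_of_lp_three f).toLp f
      map_add' := fun f g => by
        rw [← MemLp.toLp_add]
        exact MemLp.toLp_congr _ _ (Lp.coeFn_add f g)
      map_smul' := fun c f => by
        rw [RingHom.id_apply, ← MemLp.toLp_const_smul]
        exact MemLp.toLp_congr _ _ (Lp.coeFn_smul c f) }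
    (μ univ ^ (1 / (2 : ℝ≥0∞).toReal - 1 / (3 : ℝ≥0∞).toReal)).toReal
    (fun f => by
      simp only [LinearMap.coe_mk, AddHom.coe_mk]
      rw [Lp.norm_toLp, Lp.norm_def, mul_comm, ← ENNReal.toReal_mul]
      refine ENNReal.toReal_mono ?_ (eLpNorm_le_eLpNorm_mul_rpow_measure_univ (by norm_num)
        (Lp.aestronglyMeasurable f))
      refine ENNReal.mul_ne_top (Lp.eLpNorm_ne_top f)
        (ENNReal.rpow_ne_top_of_nonneg (by norm_num) (measure_ne_top μ univ)))

theorem coeFn_lpInclusion (μ : Measure α) [IsFiniteMeasure μ] (f : Lp E 3 μ) :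
    lpInclusion μ f =ᵐ[μ] f := MemLp.coeFn_toLp (memLp_two_of_lp_three f)

end LpInclusion

/-- The inclusion of `W₀^{1,3}(Ω)` in `L²(Ω)`. -/
def toL2 (Ω : Set E3) [IsFiniteMeasure (volume.restrict Ω)] :
    W₀ Ω →L[ℝ] Lp E3 2 (volume.restrict Ω) :=
  lpInclusion (volume.restrict Ω) ∘L ContinuousLinearMap.fst ℝ _ _ ∘L pairL Ω

theorem coeFn_toL2 [IsFiniteMeasure (volume.restrict Ω)] (w : W₀ Ω) :
    toL2 Ω w =ᵐ[volume.restrict Ω] val w := coeFn_lpInclusion _ _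

/-- The `L²(Ω)` inner product as a bilinear form on `W₀^{1,3}(Ω)`. -/
def l2Form (Ω : Set E3) [IsFiniteMeasure (volume.restrict Ω)] : W₀ Ω →L[ℝ] W₀ Ω →L[ℝ] ℝ :=
  (innerSL ℝ (E := Lp E3 2 (volume.restrict Ω))).bilinearComp (toL2 Ω) (toL2 Ω)

theorem l2Form_apply [IsFiniteMeasure (volume.restrict Ω)] (v w : W₀ Ω) :
    l2Form Ω v w = ∫ x in Ω, inner ℝ (val v x) (val w x) := by
  change inner ℝ (toL2 Ω v) (toL2 Ω w) = _
  rw [L2.inner_def]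
  refine integral_congr_ae ?_
  filter_upwards [coeFn_toL2 v, coeFn_toL2 w] with x h1 h2
  rw [h1, h2]

theorem l2Form_self [IsFiniteMeasure (volume.restrict Ω)] (v : W₀ Ω) :
    l2Form Ω v v = ∫ x in Ω, ‖val v x‖ ^ 2 := by
  simp only [l2Form_apply, real_inner_self_eq_norm_sq]

theorem l2Form_self_eq_norm_sq [IsFiniteMeasure (volume.restrict Ω)] (v : W₀ Ω) :
    l2Form Ω v v = ‖toL2 Ω v‖ ^ 2 :=
  real_inner_self_eq_norm_sq (toL2 Ω v)

theorem l2Form_comm [IsFiniteMeasure (volume.restrict Ω)] (v w : W₀ Ω) :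
    l2Form Ω v w = l2Form Ω w v := real_inner_comm (toL2 Ω w) (toL2 Ω v)

/-- The strain-rate tensor of an element of `W₀^{1,3}(Ω)`, as an element of `L³(Ω)`. -/
def strainL (Ω : Set E3) :
    W₀ Ω →L[ℝ] Lp (EuclideanSpace ℝ (Fin 3 × Fin 3)) 3 (volume.restrict Ω) :=
  symgL.compLpL 3 (volume.restrict Ω) ∘L ContinuousLinearMap.snd ℝ _ _ ∘L pairL Ω

/-- This makes `t ↦ ∫ |D u(t)|³` a continuous function of `u(t)`, hence measurable in time without
a jointly measurable representative of `∇u`. -/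
theorem norm_strainL_pow (w : W₀ Ω) :
    ‖strainL Ω w‖ ^ 3 = ∫ x in Ω, tnorm (symg (grad w x)) ^ 3 := by
  have h : (strainL Ω w : E3 → _) =ᵐ[volume.restrict Ω] fun x => symgL (grad w x) :=
    ContinuousLinearMap.coeFn_compLpL _ _
  rw [Lp.norm_def, (Lp.memLp _).eLpNorm_eq_integral_rpow_norm (by norm_num) (by norm_num),
    ENNReal.toReal_ofReal (by positivity)]
  simp only [ENNReal.toReal_ofNat]
  rw [← Real.rpow_natCast, ← Real.rpow_mul (integral_nonneg fun x => by positivity)]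
  norm_num
  refine integral_congr_ae ?_
  filter_upwards [h] with x hx
  rw [hx, norm_symgL]

/-! ### Fubini for `Lᵖ` functions on the cylinder -/

theorem one_le_three_halves : (1 : ℝ≥0∞) ≤ 3 / 2 := by
  rw [ENNReal.le_div_iff_mul_le (by simp) (by simp)]; norm_num

theorem three_halves_ne_top : (3 / 2 : ℝ≥0∞) ≠ ⊤ := by finiteness

theorem toReal_three_halves : (3 / 2 : ℝ≥0∞).toReal = 3 / 2 := by
  rw [ENNReal.toReal_div]; norm_num

instance holderConjugate_three_halves_three : ENNReal.HolderConjugate (3 / 2) 3 where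
  inv_add_inv_eq_inv := by
    rw [ENNReal.inv_div (by simp) (by simp), inv_one, ← one_div, ENNReal.div_add_div_same]
    norm_num
    exact ENNReal.div_self (by simp) (by simp)

theorem ae_memLp_prodMk_left {α β E : Type*} [MeasurableSpace α] [MeasurableSpace β]
    {μ : Measure α} {ν : Measure β} [SFinite μ] [SFinite ν] [NormedAddCommGroup E] {p : ℝ≥0∞}
    (hp0 : p ≠ 0) (hp : p ≠ ⊤) {f : α × β → E} (hf : MemLp f p (μ.prod ν)) :
    ∀ᵐ x ∂μ, MemLp (fun y => f (x, y)) p ν := by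
  filter_upwards [hf.1.prodMk_left, (hf.integrable_norm_rpow hp0 hp).prod_right_ae] with x h1 h2
  exact (integrable_norm_rpow_iff h1 hp0 hp).mp h2

theorem cylMeasure_eq_prod (T : ℝ) (Ω : Set E3) :
    cylMeasure T Ω = (timeMeasure T).prod (volume.restrict Ω) := by
  rw [Measure.prod_restrict, ← Measure.volume_eq_prod]

/-! ### The energy identity for the fluid velocity -/

variable {T : ℝ} {Ω : Set E3}

/-- An essential limit along an interval, at one of its points or ends, is unique. -/
theorem neBot_nhdsWithin_Ioo_inf_ae {a b x : ℝ} (hab : a < b) (hx : x ∈ Icc a b) :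
    (𝓝[Ioo a b] x ⊓ ae volume).NeBot := by
  rw [inf_neBot_iff]
  intro s hs s' hs'
  obtain ⟨V, hV, hxV, hVs⟩ := mem_nhdsWithin.mp hs
  have hne : (V ∩ Ioo a b).Nonempty := by
    have : x ∈ closure (Ioo a b) := by rwa [closure_Ioo hab.ne]
    exact mem_closure_iff.mp this V hV hxV
  have hpos : 0 < volume (V ∩ Ioo a b) := (hV.inter isOpen_Ioo).measure_pos _ hne
  by_contra hempty
  refine hpos.ne' (measure_mono_null (fun y hy hys => hempty ⟨y, hVs hy, hys⟩) hs')

theorem eventually_nhdsWithin_inf_ae {a b x : ℝ} {P : ℝ → Prop}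
    (h : ∀ᵐ t ∂(volume.restrict (Ioo a b)), P t) :
    ∀ᶠ t in 𝓝[Ioo a b] x ⊓ ae volume, P t := by
  rw [ae_restrict_iff' measurableSet_Ioo] at h
  have h1 : ∀ᶠ t in 𝓝[Ioo a b] x ⊓ ae volume, t ∈ Ioo a b :=
    Eventually.filter_mono inf_le_left self_mem_nhdsWithin
  filter_upwards [h1, Eventually.filter_mono inf_le_right h] with t h2 h3 using h3 h2

theorem HasInitialValue.tendsto_energy [IsFiniteMeasure (volume.restrict Ω)] {u : ℝ → W₀ Ω}
    {v : E3 → E3} (hv : MemLp v 2 (volume.restrict Ω)) (h : HasInitialValue T Ω u v) :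
    Tendsto (fun t => l2Form Ω (u t) (u t)) (𝓝[Ioo 0 T] 0 ⊓ ae volume)
      (𝓝 (∫ x in Ω, ‖v x‖ ^ 2)) := by
  have h1 : Tendsto (fun t => toL2 Ω (u t)) (𝓝[Ioo 0 T] 0 ⊓ ae volume) (𝓝 (hv.toLp v)) := by
    rw [Lp.tendsto_Lp_iff_tendsto_eLpNorm']
    refine h.congr fun t => eLpNorm_congr_ae ?_
    filter_upwards [coeFn_toL2 (u t), hv.coeFn_toLp] with x h2 h3
    rw [Pi.sub_apply, h2, h3]
  have h2 : ∫ x in Ω, ‖v x‖ ^ 2 = ‖hv.toLp v‖ ^ 2 := by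
    rw [← real_inner_self_eq_norm_sq, L2.inner_def]
    refine integral_congr_ae ?_
    filter_upwards [hv.coeFn_toLp] with x h3
    rw [h3, real_inner_self_eq_norm_sq]
  simp only [l2Form_self_eq_norm_sq]
  rw [h2]
  exact h1.norm.pow 2

/-- The energy balance `∫₀ᵀ ⟨∂ₜu, u⟩ = (|u(T)|² - |u(0)|²) / 2`. -/
theorem integral_timeDeriv_apply_self [IsFiniteMeasure (volume.restrict Ω)] (hT : 0 < T)
    {uinit : E3 → E3} (huinit : MemLp uinit 2 (volume.restrict Ω)) {u : ℝ → W₀ Ω}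
    {g : ℝ → WDual Ω} (hu : MemLp u 3 (timeMeasure T)) (hg : MemLp g (3 / 2) (timeMeasure T))
    (hder : IsTimeDeriv T Ω u g) (hinit : HasInitialValue T Ω u uinit) :
    ∫ t in Ioo 0 T, g t (u t) =
      (1 / 2 : ℝ) * finalEnergy T Ω u - (1 / 2 : ℝ) * ∫ x in Ω, ‖uinit x‖ ^ 2 := by
  have hgu : IntegrableOn (fun t => g t (u t)) (Ioo 0 T) := MemLp.integrable_apply hg hu
  have hi : IntervalIntegrable (fun t => 2 * g t (u t)) volume 0 T := by
    rw [intervalIntegrable_iff_integrableOn_Ioo_of_le hT.le]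
    exact hgu.const_mul 2
  have hcont : ContinuousOn (fun t => ∫ s in (0 : ℝ)..t, 2 * g s (u s)) (Icc 0 T) := by
    have := intervalIntegral.continuousOn_primitive_interval' hi left_mem_uIcc
    rwa [uIcc_of_le hT.le] at this
  obtain ⟨c, hc⟩ := ae_bilin_eq_const_add_primitive (p := 3 / 2) (q := 3) one_le_three_halves
    three_halves_ne_top (by norm_num) (by norm_num) hT (l2Form_comm (Ω := Ω)) hg hu (by
      intro θ h1 h2 h3 w
      simp only [l2Form_apply]
      exact hder θ h1 h2 h3 w)
  have hlim : ∀ x ∈ Icc 0 T, Tendsto (fun t => l2Form Ω (u t) (u t))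
      (𝓝[Ioo 0 T] x ⊓ ae volume) (𝓝 (c + ∫ s in (0 : ℝ)..x, 2 * g s (u s))) := by
    intro x hx
    have h1 : Tendsto (fun t => c + ∫ s in (0 : ℝ)..t, 2 * g s (u s)) (𝓝[Ioo 0 T] x ⊓ ae volume)
        (𝓝 (c + ∫ s in (0 : ℝ)..x, 2 * g s (u s))) :=
      (tendsto_const_nhds.add ((hcont x hx).mono_left
        (nhdsWithin_mono _ Ioo_subset_Icc_self))).mono_left inf_le_left
    refine h1.congr' ?_
    filter_upwards [eventually_nhdsWithin_inf_ae hc] with t ht using ht.symm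
  have := neBot_nhdsWithin_Ioo_inf_ae hT (left_mem_Icc.mpr hT.le)
  have := neBot_nhdsWithin_Ioo_inf_ae hT (right_mem_Icc.mpr hT.le)
  have e0 := tendsto_nhds_unique (hlim 0 (left_mem_Icc.mpr hT.le)) (hinit.tendsto_energy huinit)
  -- the limit at `T` exists, so the lower limit in `finalEnergy` is not a junk value
  have eT : finalEnergy T Ω u = c + ∫ s in (0 : ℝ)..T, 2 * g s (u s) := by
    have := (hlim T (right_mem_Icc.mpr hT.le)).liminf_eq
    simp only [l2Form_self] at this
    exact this
  rw [intervalIntegral.integral_same, add_zero] at e0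
  rw [eT, ← e0, intervalIntegral.integral_const_mul, intervalIntegral.integral_of_le hT.le,
    integral_Ioc_eq_integral_Ioo]
  ring

/-! ### The dissipation defect -/

/-- The defect `2 q |S| - s : S` in the threshold relation. -/
def defect (s : Tensor) (q : ℝ) (L : E3 →L[ℝ] E3) : ℝ :=
  2 * (q * tnorm (devg L)) - contract s (devg L)

theorem defect_nonneg {s : Tensor} {q : ℝ} (h : tnorm s ≤ q) (L : E3 →L[ℝ] E3) :
    0 ≤ defect s q L := by
  have h1 := contract_le s (devg L)
  have h2 := mul_le_mul_of_nonneg_right h (tnorm_nonneg (devg L))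
  rw [defect]
  linarith

theorem thresholdRelations_of_defect_eq_zero {s : Tensor} {q : ℝ} {L : E3 →L[ℝ] E3}
    (h : defect s q L = 0) (h1 : tnorm s ≤ q) (h2 : s = sᵀ) (h3 : s.trace = 0) :
    ThresholdRelations s q L := by
  refine ⟨?_, h1, h2, h3⟩
  rw [defect] at h
  linarith

section Slice

variable {q : E3 → ℝ} {s : E3 → Tensor}

theorem integrable_mul_tnorm_devg (hq : MemLp q (3 / 2) (volume.restrict Ω)) (w : W₀ Ω) :
    Integrable (fun x => q x * tnorm (devg (grad w x))) (volume.restrict Ω) := by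
  have := hq.integrable_mul (devgL.comp_memLp' (memLp_grad w)).norm
  refine this.congr (Eventually.of_forall fun x => ?_)
  simp [norm_devgL]

theorem integrable_contract_devg (hs : ∀ i j, MemLp (fun x => s x i j) (3 / 2) (volume.restrict Ω))
    (w : W₀ Ω) : Integrable (fun x => contract (s x) (devg (grad w x))) (volume.restrict Ω) := by
  simp only [contract_eq_sum]
  exact integrable_finsetSum _ fun i _ => integrable_finsetSum _ fun j _ =>
    (hs j i).integrable_mul ((devgEntryL j i).comp_memLp' (memLp_grad w))

end Slice

/-- Testing the momentum equation with the velocity and the dilatancy law with the pressure. The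
integrals `∫ p div u` of the two equations cancel. -/
theorem IsWeakSolution.ae_integral_defect {uinit : E3 → E3} {f : ℝ → WDual Ω} {u : ℝ → W₀ Ω}
    {p : ℝ × E3 → ℝ} {σ : ℝ × E3 → Tensor} (h : IsWeakSolution T Ω uinit f u p σ)
    {g : ℝ → WDual Ω}
    (hmom : ∀ᵐ t ∂(timeMeasure T),
      g t (u t) - (∫ x in Ω, p (t, x) * divg (grad (u t) x))
        + (∫ x in Ω, 2 * tnorm (symg (grad (u t) x)) *
            contract (symg (grad (u t) x)) (symg (grad (u t) x)))
        + (∫ x in Ω, contract (σ (t, x)) (devg (grad (u t) x))) = f t (u t)) :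
    ∀ᵐ t ∂(timeMeasure T),
      Integrable (fun x => defect (σ (t, x)) (p (t, x)) (grad (u t) x)) (volume.restrict Ω) ∧
      ∫ x in Ω, defect (σ (t, x)) (p (t, x)) (grad (u t) x) =
        g t (u t) + 4 * (∫ x in Ω, tnorm (symg (grad (u t) x)) ^ 3)
          + (∫ x in Ω, |p (t, x)| ^ (3 / 2 : ℝ)) - f t (u t) := by
  have hp := h.p_memLp
  have hp0 := h.p_nonneg
  have hσ := h.stress_memLp
  rw [cylMeasure_eq_prod] at hp hp0 hσ
  have h32 : (3 / 2 : ℝ≥0∞) ≠ 0 := (zero_lt_one.trans_le one_le_three_halves).ne'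
  have hσ' : ∀ᵐ t ∂(timeMeasure T), ∀ i j,
      MemLp (fun x => σ (t, x) i j) (3 / 2) (volume.restrict Ω) := by
    simp only [ae_all_iff]
    exact fun i j => ae_memLp_prodMk_left h32 three_halves_ne_top (hσ i j)
  filter_upwards [hmom, h.dilatancy p h.p_memLp, hσ',
    ae_memLp_prodMk_left h32 three_halves_ne_top hp, Measure.ae_ae_of_ae_prod hp0]
    with t h1 h2 h3 h4 h5
  have i1 := (integrable_mul_tnorm_devg h4 (u t)).const_mul 2
  have i2 := integrable_contract_devg h3 (u t)
  refine ⟨i1.sub i2, ?_⟩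
  have e1 : ∫ x in Ω, 2 * tnorm (symg (grad (u t) x)) *
      contract (symg (grad (u t) x)) (symg (grad (u t) x))
        = 4 * ∫ x in Ω, tnorm (symg (grad (u t) x)) ^ 3 := by
    rw [← integral_const_mul]
    refine integral_congr_ae (Eventually.of_forall fun x => ?_)
    simp only [contract_self]
    ring
  have e2 : ∫ x in Ω, p (t, x) * Real.sqrt (p (t, x)) = ∫ x in Ω, |p (t, x)| ^ (3 / 2 : ℝ) := by
    refine integral_congr_ae ?_
    filter_upwards [h5] with x hx
    rw [abs_of_nonneg hx, Real.sqrt_eq_rpow]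
    have : (3 / 2 : ℝ) = 1 + 1 / 2 := by norm_num
    rw [this, Real.rpow_add_of_nonneg hx (by norm_num) (by norm_num), Real.rpow_one]
  have e3 : ∫ x in Ω, defect (σ (t, x)) (p (t, x)) (grad (u t) x)
      = (∫ x in Ω, 2 * p (t, x) * tnorm (devg (grad (u t) x)))
        - ∫ x in Ω, contract (σ (t, x)) (devg (grad (u t) x)) := by
    simp only [defect, mul_assoc]
    exact integral_sub i1 i2
  rw [e1] at h1
  rw [e2] at h2
  rw [e3]
  linarith

/-- The defect vanishes: its space-time integral is nonpositive by the energy inequality. -/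
theorem IsWeakSolution.ae_defect_eq_zero [IsFiniteMeasure (volume.restrict Ω)] (hT : 0 < T)
    {uinit : E3 → E3} (huinit : MemLp uinit 2 (volume.restrict Ω)) {f : ℝ → WDual Ω}
    (hf : MemLp f (3 / 2) (timeMeasure T)) {u : ℝ → W₀ Ω}
    {p : ℝ × E3 → ℝ} {σ : ℝ × E3 → Tensor} (h : IsWeakSolution T Ω uinit f u p σ) :
    ∀ᵐ t ∂(timeMeasure T), ∀ᵐ x ∂(volume.restrict Ω),
      defect (σ (t, x)) (p (t, x)) (grad (u t) x) = 0 := by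
  obtain ⟨g, hg, hder, hmom⟩ := h.momentum
  have hdef := h.ae_integral_defect (hmom u h.u_memLp)
  have hle := h.stress_le
  rw [cylMeasure_eq_prod] at hle
  have hle' := Measure.ae_ae_of_ae_prod hle
  have hpi : Integrable (fun z => |p z| ^ (3 / 2 : ℝ))
      ((timeMeasure T).prod (volume.restrict Ω)) := by
    have := h.p_memLp.integrable_norm_rpow (zero_lt_one.trans_le one_le_three_halves).ne'
      three_halves_ne_top
    rwa [cylMeasure_eq_prod, toReal_three_halves] at this
  have i1 : Integrable (fun t => g t (u t)) (timeMeasure T) :=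
    MemLp.integrable_apply hg h.u_memLp
  have i2 : Integrable (fun t => ∫ x in Ω, tnorm (symg (grad (u t) x)) ^ 3) (timeMeasure T) := by
    simp only [← norm_strainL_pow]
    have := ((strainL Ω).comp_memLp' h.u_memLp).integrable_norm_pow (by norm_num)
    exact this
  have i3 : Integrable (fun t => ∫ x in Ω, |p (t, x)| ^ (3 / 2 : ℝ)) (timeMeasure T) :=
    hpi.integral_prod_left
  have i4 : Integrable (fun t => f t (u t)) (timeMeasure T) :=
    MemLp.integrable_apply hf h.u_memLp
  have i12 : Integrable (fun t => g t (u t) + 4 * ∫ x in Ω, tnorm (symg (grad (u t) x)) ^ 3)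
      (timeMeasure T) := i1.add (i2.const_mul 4)
  have i123 : Integrable (fun t => g t (u t) + 4 * (∫ x in Ω, tnorm (symg (grad (u t) x)) ^ 3)
      + ∫ x in Ω, |p (t, x)| ^ (3 / 2 : ℝ)) (timeMeasure T) := i12.add i3
  have hnn : ∀ᵐ t ∂(timeMeasure T), ∀ᵐ x ∂(volume.restrict Ω),
      0 ≤ defect (σ (t, x)) (p (t, x)) (grad (u t) x) := by
    filter_upwards [hle'] with t ht
    filter_upwards [ht] with x hx using defect_nonneg hx _
  -- the total defect in time, whose measurability is read off from the other terms
  have iD : Integrable (fun t => ∫ x in Ω, defect (σ (t, x)) (p (t, x)) (grad (u t) x))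
      (timeMeasure T) := by
    refine (i123.sub i4).congr ?_
    filter_upwards [hdef] with t ht
    rw [ht.2]; rfl
  have hD : ∫ t in Ioo 0 T, ∫ x in Ω, defect (σ (t, x)) (p (t, x)) (grad (u t) x) ≤ 0 := by
    have e : ∫ t in Ioo 0 T, ∫ x in Ω, defect (σ (t, x)) (p (t, x)) (grad (u t) x) =
        ((∫ t in Ioo 0 T, g t (u t))
          + 4 * ∫ t in Ioo 0 T, ∫ x in Ω, tnorm (symg (grad (u t) x)) ^ 3)
          + (∫ t in Ioo 0 T, ∫ x in Ω, |p (t, x)| ^ (3 / 2 : ℝ))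
          - ∫ t in Ioo 0 T, f t (u t) := by
      rw [← integral_const_mul, ← integral_add i1 (i2.const_mul 4),
        ← integral_add i12 i3, ← integral_sub i123 i4]
      refine integral_congr_ae ?_
      filter_upwards [hdef] with t ht using ht.2
    rw [e, integral_timeDeriv_apply_self hT huinit h.u_memLp hg hder h.initial]
    linarith [h.energy]
  have hDnn : 0 ≤ᵐ[timeMeasure T]
      fun t => ∫ x in Ω, defect (σ (t, x)) (p (t, x)) (grad (u t) x) := by
    filter_upwards [hnn] with t ht using integral_nonneg_of_ae ht
  have hD0 := (integral_eq_zero_iff_of_nonneg_ae hDnn iD).mp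
    (le_antisymm hD (integral_nonneg_of_ae hDnn))
  filter_upwards [hD0, hnn, hdef] with t h1 h2 h3
  exact (integral_eq_zero_iff_of_nonneg_ae h2 h3.1).mp h1

theorem aestronglyMeasurable_defect {p : ℝ × E3 → ℝ} {σ : ℝ × E3 → Tensor}
    {G : ℝ × E3 → E3 →L[ℝ] E3} {μ : Measure (ℝ × E3)} (hp : AEStronglyMeasurable p μ)
    (hσ : ∀ i j, AEStronglyMeasurable (fun z => σ z i j) μ) (hG : AEStronglyMeasurable G μ) :
    AEStronglyMeasurable (fun z => defect (σ z) (p z) (G z)) μ := by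
  simp only [defect, contract_eq_sum, ← norm_devgL, ← devgEntryL_apply]
  refine ((hp.mul (devgL.continuous.comp_aestronglyMeasurable hG).norm).const_mul 2).sub ?_
  refine Finset.aestronglyMeasurable_fun_sum _ fun i _ =>
    Finset.aestronglyMeasurable_fun_sum _ fun j _ => ?_
  exact (hσ j i).mul ((devgEntryL j i).continuous.comp_aestronglyMeasurable hG)

/-- The converse of Fubini for null sets needs measurability, here that of `F`. -/
theorem ae_prod_eq_zero_of_ae_ae {α β : Type*} [MeasurableSpace α] [MeasurableSpace β]
    {μ : Measure α} {ν : Measure β} [SFinite μ] [SFinite ν] {F : α × β → ℝ}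
    (hF : AEStronglyMeasurable F (μ.prod ν)) (h : ∀ᵐ x ∂μ, ∀ᵐ y ∂ν, F (x, y) = 0) :
    ∀ᵐ z ∂(μ.prod ν), F z = 0 := by
  have h1 : ∀ᵐ z ∂(μ.prod ν), hF.mk F z = 0 := by
    rw [Measure.ae_prod_iff_ae_ae (p := fun z => hF.mk F z = 0)
      (hF.stronglyMeasurable_mk.measurable (measurableSet_singleton 0))]
    filter_upwards [h, Measure.ae_ae_of_ae_prod hF.ae_eq_mk] with x h2 h3
    filter_upwards [h2, h3] with y h4 h5
    rw [← h5, h4]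
  filter_upwards [h1, hF.ae_eq_mk] with z h2 h3
  rw [h3, h2]

end GranularFlow

end

/-! ### The threshold relations -/

theorem proposition1 (T : ℝ) (hT : 0 < T) (Ω : Set GranularFlow.E3) (hΩ : IsOpen Ω)
    (hΩb : Bornology.IsBounded Ω)
    (uinit : GranularFlow.E3 → GranularFlow.E3) (huinit : MemLp uinit 2 (volume.restrict Ω))
    (f : ℝ → GranularFlow.WDual Ω) (hf : MemLp f (3 / 2) (GranularFlow.timeMeasure T))
    (u : ℝ → GranularFlow.W₀ Ω) (p : ℝ × GranularFlow.E3 → ℝ)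
    (σ : ℝ × GranularFlow.E3 → GranularFlow.Tensor)
    (h : GranularFlow.IsWeakSolution T Ω uinit f u p σ) :
    (∀ᵐ t ∂(GranularFlow.timeMeasure T), ∀ᵐ x ∂(volume.restrict Ω),
        GranularFlow.ThresholdRelations (σ (t, x)) (p (t, x)) (GranularFlow.grad (u t) x)) ∧
      ∀ G : ℝ × GranularFlow.E3 → GranularFlow.E3 →L[ℝ] GranularFlow.E3,
        GranularFlow.IsSpaceTimeGradient T Ω u G →
          ∀ᵐ z ∂(GranularFlow.cylMeasure T Ω),
            GranularFlow.ThresholdRelations (σ z) (p z) (G z) := by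
  have : IsFiniteMeasure (volume.restrict Ω) :=
    isFiniteMeasure_restrict.mpr hΩb.measure_lt_top.ne
  have key := h.ae_defect_eq_zero hT huinit hf
  have hle := h.stress_le
  have hsymm := h.stress_symm
  have htr := h.stress_trace
  refine ⟨?_, fun G hG => ?_⟩
  · rw [GranularFlow.cylMeasure_eq_prod] at hle hsymm htr
    filter_upwards [key, Measure.ae_ae_of_ae_prod hle, Measure.ae_ae_of_ae_prod hsymm,
      Measure.ae_ae_of_ae_prod htr] with t h0 h1 h2 h3
    filter_upwards [h0, h1, h2, h3] with x h4 h5 h6 h7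
    exact GranularFlow.thresholdRelations_of_defect_eq_zero h4 h5 h6 h7
  · have hmeas := GranularFlow.aestronglyMeasurable_defect h.p_memLp.1
      (fun i j => (h.stress_memLp i j).1) hG.1
    have hzero : ∀ᵐ z ∂(GranularFlow.cylMeasure T Ω),
        GranularFlow.defect (σ z) (p z) (G z) = 0 := by
      rw [GranularFlow.cylMeasure_eq_prod] at hmeas ⊢
      refine GranularFlow.ae_prod_eq_zero_of_ae_ae hmeas ?_
      filter_upwards [key, hG.2] with t h0 h1
      filter_upwards [h0, h1] with x h2 h3
      rw [h3, h2]
    filter_upwards [hzero, hle, hsymm, htr] with z h4 h5 h6 h7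
    exact GranularFlow.thresholdRelations_of_defect_eq_zero h4 h5 h6 h7
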